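/- Let $(\Theta,\mathcal F)$ and $(\mathscr D,\mathcal A)$ be measurable spaces, and let $\Delta(\cdot)$ denote the countably additive probability measures on a measurable space. For a set $\mathcal Q$ of probability measures let $\overline Q(A)=\sup_{Q\in\mathcal Q}Q(A)$ be its upper probability. For a set function $u$ let $\mathrm{core}(u)$ be the set of countably additive probability measures $P$ with $P(A)\le u(A)$ for all measurable $A$. Call $u$ concave (2-alternating) if $u(A\cup B)\le u(A)+u(B)-u(A\cap B)$ for all measurable $A,B$. A set of probability measures is weak$^\star$-closed if it is closed, for setwise convergence, in the space of all finitely additive probabilities. Let $\mathcal P\subset\Delta(\Theta,\mathcal F)$ have upper probability $\overline P$ and let $\mathcal P^{\rm co}=\mathrm{core}(\overline P)$, where every $P\in\mathcal P^{\rm co}$ has a density with respect to a $\sigma$-finite measure $\mu$ on $\Theta$. For each $\theta\in\Theta$ let $\mathcal L_\theta\subset\Delta(\mathscr D,\mathcal A)$ have upper probability $\overline P_\theta$ and let $\mathcal L^{\rm co}_\theta=\mathrm{core}(\overline P_\theta)$; for every $P_\theta\in\mathcal L_\theta^{\rm co}$ fix a version $\frac{\mathrm dP_\theta}{\mathrm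 d\nu}\geq 0$ of its density with respect to a $\sigma$-finite measure $\nu$ on $\mathscr D$. For $y\in\mathscr D$ let $\mathscr L_y$ be the set of bounded, non-negative, measurable functions $L:\Theta\to\mathbb R$ such that for every $\theta$ there is $P_\theta\in\mathcal L^{\rm co}_\theta$ with $L(\theta)=\frac{\mathrm dP_\theta}{\mathrm d\nu}(y)$. Let $\mathcal P^{\rm co}_y$ be the set of probability measures on $\Theta$ with $\mu$-density $\dfrac{L\,p}{\int_\Theta L\,p\,\mathrm d\mu}$, where $p=\frac{\mathrm dP}{\mathrm d\mu}$, $P\in\mathcal P^{\rm co}$, $L\in\mathscr L_y$ and $\int_\Theta L\,p\,\mathrm d\mu>0$, and let $\overline P_y(A)=\sup_{P_y\in\mathcal P^{\rm co}_y}P_y(A)$ be the upper posterior (with $\sup\emptyset=0$). Suppose $\mathcal P^{\rm co}$ and all $\mathcal L^{\rm co}_\theta$ are nonempty and weak$^\star$-closed, and $\overline P$ is concave. Then: 1. for every $y\in\mathscr D$, $\overline P_y$ is concave; 2. consequently the update can be iterated: for observations $y_0,y_1,\dots$ let $\overline P^{(0)}=\overline P$, and let $\overline P^{(t+1)}$ be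 the upper posterior obtained from the prior set $\mathrm{core}(\overline P^{(t)})$ and the likelihood functions $\mathscr L_{y_t}$. If $\mathrm{core}(\overline P^{(t)})$ is nonempty and weak$^\star$-closed for every $t<n$, then $\overline P^{(n)}$ is concave. -/

import Mathlib

open MeasureTheory
open scoped ENNReal

noncomputable section

/-- The upper probability `A ↦ sup_{P ∈ 𝒬} P(A)` associated with a set `𝒬` of countably additive
probability measures. -/
def upperProb {Ω : Type*} [MeasurableSpace Ω] (𝒬 : Set (ProbabilityMeasure Ω)) (A : Set Ω) : ℝ :=
  sSup ((fun P : ProbabilityMeasure Ω => (P : Measure Ω).real A) '' 𝒬)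

/-- A set function is concave (2-alternating) if
`u (A ∪ B) ≤ u A + u B - u (A ∩ B)` for all measurable `A`, `B`. -/
def TwoAlternating {Ω : Type*} [MeasurableSpace Ω] (u : Set Ω → ℝ) : Prop :=
  ∀ A B : Set Ω, MeasurableSet A → MeasurableSet B → u (A ∪ B) ≤ u A + u B - u (A ∩ B)

/-- The core of a set function: the countably additive probability measures that it dominates
on every measurable set. -/
def upperCore {Ω : Type*} [MeasurableSpace Ω] (u : Set Ω → ℝ) : Set (ProbabilityMeasure Ω) :=
  {P | ∀ A : Set Ω, MeasurableSet A → (P : Measure Ω).real A ≤ u A}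

/-- Finitely additive probabilities on the σ-algebra of `Ω`. -/
structure FinAddProb (Ω : Type*) [MeasurableSpace Ω] where
  /-- the value on a measurable set -/
  toFun : {A : Set Ω // MeasurableSet A} → ℝ
  nonneg' : ∀ A, 0 ≤ toFun A
  univ' : toFun ⟨Set.univ, MeasurableSet.univ⟩ = 1
  union' : ∀ A B : {A : Set Ω // MeasurableSet A}, Disjoint A.1 B.1 →
    toFun ⟨A.1 ∪ B.1, A.2.union B.2⟩ = toFun A + toFun B

/-- The weak* topology on finitely additive probabilities: `Q_α → Q` if and only if
`Q_α(A) → Q(A)` for every measurable `A`. -/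
instance {Ω : Type*} [MeasurableSpace Ω] : TopologicalSpace (FinAddProb Ω) :=
  TopologicalSpace.induced FinAddProb.toFun inferInstance

/-- A countably additive probability measure, seen as a finitely additive probability. -/
def FinAddProb.ofProbabilityMeasure {Ω : Type*} [MeasurableSpace Ω] (P : ProbabilityMeasure Ω) :
    FinAddProb Ω where
  toFun A := (P : Measure Ω).real A.1
  nonneg' _ := measureReal_nonneg
  univ' := by simp
  union' A B h := measureReal_union h B.2

/-- A set of countably additive probability measures is weak*-closed if it is closed in the
(weak*-compact) space of all finitely additive probabilities. -/
def WeakStarClosed {Ω : Type*} [MeasurableSpace Ω] (C : Set (ProbabilityMeasure Ω)) : Prop :=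
  IsClosed (FinAddProb.ofProbabilityMeasure '' C)

/-- The bounded, non-negative, measurable functionals on `Θ`. -/
def boundedNonnegMeasurable (Θ : Type*) [MeasurableSpace Θ] : Set (Θ → ℝ) :=
  {Y | Measurable Y ∧ (∀ θ, 0 ≤ Y θ) ∧ ∃ M : ℝ, ∀ θ, Y θ ≤ M}

/-- The likelihood functions at the observation `y`. The set `ℒ θ` holds the plausible sampling
distributions given `θ`, and `dens θ Q` is the density of `Q` (in the core of the upper
probability of `ℒ θ`). A likelihood function is a bounded, non-negative, measurable
`L : Θ → ℝ` which, for each `θ`, is the density at `y` of some element of that core. -/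
def likelihoodSet {Θ D : Type*} [MeasurableSpace Θ] [MeasurableSpace D]
    (ℒ : Θ → Set (ProbabilityMeasure D)) (dens : Θ → ProbabilityMeasure D → D → ℝ) (y : D) :
    Set (Θ → ℝ) :=
  {L | L ∈ boundedNonnegMeasurable Θ ∧
    ∀ θ, ∃ Q ∈ upperCore (upperProb (ℒ θ)), L θ = dens θ Q y}

/-- The class of posteriors obtained by Bayes' rule from the priors in `C` and the likelihood
functions in `𝓛`: the probability measures with `μ`-density `L p / ∫ L p dμ`, where `p` is the
`μ`-density of a prior in `C`, `L` is in `𝓛`, and the normalizing constant does not vanish. -/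
def posteriorClass {Θ : Type*} [MeasurableSpace Θ] (μ : Measure Θ)
    (C : Set (ProbabilityMeasure Θ)) (𝓛 : Set (Θ → ℝ)) : Set (ProbabilityMeasure Θ) :=
  {Py | ∃ P ∈ C, ∃ p : Θ → ℝ≥0∞, Measurable p ∧ (P : Measure Θ) = μ.withDensity p ∧
    ∃ L ∈ 𝓛, 0 < ∫⁻ θ, ENNReal.ofReal (L θ) * p θ ∂μ ∧
      (Py : Measure Θ) = μ.withDensity
        (fun θ => ENNReal.ofReal (L θ) * p θ / ∫⁻ θ', ENNReal.ofReal (L θ') * p θ' ∂μ)}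

/-- Iterated generalized Bayesian updating along observations `y 0, y 1, …`: the beliefs at time
`t` are the core of the upper probability of the `t`-th set, and the next set is the class of
posteriors obtained from these beliefs after observing `y t`. -/
def iteratedPosterior {Θ D : Type*} [MeasurableSpace Θ] [MeasurableSpace D] (μ : Measure Θ)
    (𝒬 : Set (ProbabilityMeasure Θ)) (ℒ : Θ → Set (ProbabilityMeasure D))
    (dens : Θ → ProbabilityMeasure D → D → ℝ) (y : ℕ → D) : ℕ → Set (ProbabilityMeasure Θ)
  | 0 => 𝒬
  | t + 1 => posteriorClass μ (upperCore (upperProb (iteratedPosterior μ 𝒬 ℒ dens y t)))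
      (likelihoodSet ℒ dens (y t))

end

/-! Take two posteriors, with likelihoods `L₁` and `L₂`, and put `U = max L₁ L₂`, `l = min L₁ L₂`.
Both are again likelihood functions, since likelihoods can be pasted along measurable sets. Let `x
A` be the Choquet integral of `U` over `A` for the prior upper probability, and `z A` that of `l`
over `Aᶜ` for its conjugate. Each of the two posteriors is at most `x / (x + z)` on every event
(`real_le_div_layerIntegrals`). Conversely `x A / (x A + z A)` is at most the upper posterior of
`A`: use the likelihood `U` on `A` and `l` off `A`, with one prior attaining both integrals
(`div_layerIntegrals_le_upperProb`). Concavity makes `x` submodular, `z` supermodular and `x + z`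
increasing, and these facts make the ratio submodular (`div_add_submodular`).

The prior attaining both integrals must agree with the upper probability on a chain of level sets. A
Zorn argument yields a modular minorant that does so; compactness of the finitely additive
probabilities and closedness of the core make it countably additive. -/

/-! ### Modular minorants of submodular functions -/

/-- Below a monotone submodular function on a bounded distributive lattice there is a modular one
that agrees with it on a given chain. -/
theorem exists_modular_le_of_isChain {α : Type*} [DistribLattice α] [BoundedOrder α] (u : α → ℝ)
    (hu : Monotone u) (hsub : ∀ a b, u (a ⊔ b) + u (a ⊓ b) ≤ u a + u b)
    (c : Set α) (hc : IsChain (· ≤ ·) c) (hbot : ⊥ ∈ c) :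
    ∃ v : α → ℝ, Monotone v ∧ v ≤ u ∧ (∀ a ∈ c, v a = u a) ∧
      ∀ a b, v (a ⊔ b) + v (a ⊓ b) = v a + v b := by
  let S : Set (α → ℝ) := {v | Monotone v ∧ v ≤ u ∧ (∀ a ∈ c, v a = u a) ∧
      ∀ a b, v (a ⊔ b) + v (a ⊓ b) ≤ v a + v b}
  have huS : u ∈ S := ⟨hu, le_rfl, fun _ _ => rfl, hsub⟩
  have hlb : ∀ K ⊆ S, IsChain (· ≤ ·) K → ∀ v₀ ∈ K, ∃ w ∈ S, ∀ v ∈ K, w ≤ v := by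
    intro K hKS hK v₀ hv₀
    have : Nonempty K := ⟨⟨v₀, hv₀⟩⟩
    have hbdd : ∀ a, BddBelow (Set.range fun v : K => (v : α → ℝ) a) := by
      intro a
      refine ⟨u ⊥, ?_⟩
      rintro _ ⟨v, rfl⟩
      have h := hKS v.2
      have h' : (v : α → ℝ) ⊥ = u ⊥ := h.2.2.1 ⊥ hbot
      show u ⊥ ≤ (v : α → ℝ) a
      rw [← h']
      exact h.1 bot_le
    have hle : ∀ v : K, ∀ a, (⨅ w : K, (w : α → ℝ) a) ≤ (v : α → ℝ) a := fun v a =>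
      ciInf_le (hbdd a) v
    refine ⟨fun a => ⨅ w : K, (w : α → ℝ) a, ⟨?_, ?_, ?_, ?_⟩, fun v hv a => hle ⟨v, hv⟩ a⟩
    · exact fun a b hab => le_ciInf fun v => (hle v a).trans ((hKS v.2).1 hab)
    · exact fun a => (hle ⟨v₀, hv₀⟩ a).trans ((hKS hv₀).2.1 a)
    · intro a ha
      have : ∀ w : K, (w : α → ℝ) a = u a := fun w => (hKS w.2).2.2.1 a ha
      simp [this]
    · intro a b
      -- Submodularity survives the infimum because `K` is a chain: the smaller of `v` and `w`
      -- handles both terms at once.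
      have key : ∀ v w : K, (⨅ w : K, (w : α → ℝ) (a ⊔ b)) + (⨅ w : K, (w : α → ℝ) (a ⊓ b)) ≤
          (v : α → ℝ) a + (w : α → ℝ) b := by
        intro v w
        obtain ⟨m, hmv, hmw⟩ : ∃ m : K, (m : α → ℝ) ≤ (v : α → ℝ) ∧ (m : α → ℝ) ≤ (w : α → ℝ) := by
          rcases hK.total v.2 w.2 with h | h
          · exact ⟨v, le_rfl, h⟩
          · exact ⟨w, h, le_rfl⟩
        have h1 : (m : α → ℝ) (a ⊔ b) + (m : α → ℝ) (a ⊓ b) ≤ (m : α → ℝ) a + (m : α → ℝ) b :=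
          (hKS m.2).2.2.2 a b
        linarith [hle m (a ⊔ b), hle m (a ⊓ b), hmv a, hmw b]
      have h2 : ∀ v : K, (⨅ w : K, (w : α → ℝ) (a ⊔ b)) + (⨅ w : K, (w : α → ℝ) (a ⊓ b))
          - (v : α → ℝ) a ≤ ⨅ w : K, (w : α → ℝ) b := fun v =>
        le_ciInf fun w => by linarith [key v w]
      have h3 : (⨅ w : K, (w : α → ℝ) (a ⊔ b)) + (⨅ w : K, (w : α → ℝ) (a ⊓ b))
          - (⨅ w : K, (w : α → ℝ) b) ≤ ⨅ w : K, (w : α → ℝ) a :=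
        le_ciInf fun v => by linarith [h2 v]
      show (⨅ w : K, (w : α → ℝ) (a ⊔ b)) + (⨅ w : K, (w : α → ℝ) (a ⊓ b)) ≤
        (⨅ w : K, (w : α → ℝ) a) + ⨅ w : K, (w : α → ℝ) b
      linarith
  obtain ⟨v, hvu, hv⟩ : ∃ v, v ≤ u ∧ Minimal (· ∈ S) v := by
    obtain ⟨v, hvu, hv⟩ := zorn_le_nonempty₀ (α := (α → ℝ)ᵒᵈ) S
      (fun K hKS hK v₀ hv₀ => hlb K hKS hK.symm v₀ hv₀) u huS
    exact ⟨v, hvu, hv⟩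
  obtain ⟨hmono, -, hvc, hvsub⟩ := hv.prop
  -- The competitor `b ↦ v (a ⊓ b) + v (a ⊔ b) - v a` is monotone and, by distributivity,
  -- submodular; it lies below `v`. If it also agrees with `v` on `c`, minimality forces equality,
  -- which is modularity at `a`.
  have step : ∀ a, (∀ k ∈ c, v (a ⊓ k) + v (a ⊔ k) - v a = v k) →
      ∀ b, v (a ⊔ b) + v (a ⊓ b) = v a + v b := by
    intro a ha b
    have hmem : (fun b => v (a ⊓ b) + v (a ⊔ b) - v a) ∈ S := by
      refine ⟨fun b b' h => ?_, fun b => ?_, fun k hk => ?_, fun b b' => ?_⟩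
      · have h1 := hmono (inf_le_inf_left a h)
        have h2 := hmono (sup_le_sup_left h a)
        dsimp only
        linarith
      · have := hvsub a b
        have h2 := hvu b
        dsimp only
        linarith
      · exact (ha k hk).trans (hvc k hk)
      · have h1 := hvsub (a ⊓ b) (a ⊓ b')
        have h2 := hvsub (a ⊔ b) (a ⊔ b')
        rw [← inf_sup_left, ← inf_inf_distrib_left] at h1
        rw [← sup_inf_left, ← sup_sup_distrib_left] at h2
        dsimp only
        linarith
    have h := hv.le_of_le hmem (fun b => by
      have := hvsub a b
      dsimp only
      linarith) b
    have h' := hvsub a b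
    dsimp only at h
    linarith
  -- For `k` in the chain, agreement on `c` is automatic by comparability. Modularity at the chain
  -- elements then supplies the agreement needed for arbitrary `a`.
  have hmodc : ∀ k ∈ c, ∀ b, v (k ⊔ b) + v (k ⊓ b) = v k + v b := by
    intro k hk
    refine step k fun k' hk' => ?_
    rcases hc.total hk hk' with h | h
    · rw [inf_eq_left.2 h, sup_eq_right.2 h]; ring
    · rw [inf_eq_right.2 h, sup_eq_left.2 h]; ring
  refine ⟨v, hmono, hvu, hvc, fun a => step a fun k hk => ?_⟩
  have := hmodc k hk a
  rw [inf_comm, sup_comm]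
  linarith

/-! ### Countable additivity from continuity at the empty set -/

open Filter Topology in
/-- A finitely additive probability that is continuous at `∅` is countably additive. -/
theorem exists_probabilityMeasure_of_modular {Ω : Type*} [MeasurableSpace Ω]
    (v : {A : Set Ω // MeasurableSet A} → ℝ) (hbot : v ⊥ = 0) (htop : v ⊤ = 1)
    (hmono : Monotone v) (hmod : ∀ A B, v (A ⊔ B) + v (A ⊓ B) = v A + v B)
    (hcont : ∀ A : ℕ → Set Ω, ∀ hA : ∀ n, MeasurableSet (A n), Antitone A → ⋂ n, A n = ∅ →
      Tendsto (fun n => v ⟨A n, hA n⟩) atTop (𝓝 0)) :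
    ∃ P : ProbabilityMeasure Ω, ∀ A (hA : MeasurableSet A), (P : Measure Ω).real A = v ⟨A, hA⟩ := by
  have hnn : ∀ A, 0 ≤ v A := fun A => hbot ▸ hmono bot_le
  have hadd : ∀ A B (hA : MeasurableSet A) (hB : MeasurableSet B), Disjoint A B →
      v ⟨A ∪ B, hA.union hB⟩ = v ⟨A, hA⟩ + v ⟨B, hB⟩ := by
    intro A B hA hB hd
    have h := hmod ⟨A, hA⟩ ⟨B, hB⟩
    have h0 : (⟨A, hA⟩ ⊓ ⟨B, hB⟩ : {A : Set Ω // MeasurableSet A}) = ⊥ :=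
      Subtype.ext hd.inter_eq
    rw [h0, hbot, add_zero] at h
    exact h
  have hsum : ∀ ⦃f : ℕ → Set Ω⦄ (h : ∀ i, MeasurableSet (f i)),
      Pairwise (Function.onFun Disjoint f) →
        HasSum (fun i => v ⟨f i, h i⟩) (v ⟨⋃ i, f i, MeasurableSet.iUnion h⟩) := by
    intro f h hd
    rw [hasSum_iff_tendsto_nat_of_nonneg fun i => hnn _]
    have hT : ∀ n, MeasurableSet (⋃ i ≥ n, f i) := fun n =>
      MeasurableSet.iUnion fun i => MeasurableSet.iUnion fun _ => h i
    have htail := hcont (fun n => ⋃ i ≥ n, f i) hT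
      (fun m n hmn => Set.iUnion₂_subset fun i hi =>
        Set.subset_biUnion_of_mem (u := f) (hmn.trans hi : m ≤ i)) (by
        refine Set.eq_empty_of_forall_notMem fun x hx => ?_
        rw [Set.mem_iInter] at hx
        obtain ⟨i, -, hi⟩ := Set.mem_iUnion₂.1 (hx 0)
        obtain ⟨j, hj, hj'⟩ := Set.mem_iUnion₂.1 (hx (i + 1))
        exact Set.disjoint_left.1 (hd (show i ≠ j by omega)) hi hj')
    -- Finite additivity writes each partial sum as the whole minus a tail; the tails decrease to
    -- `∅`, so their values tend to zero.
    have hpart : ∀ n, ∑ i ∈ Finset.range n, v ⟨f i, h i⟩ =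
        v ⟨⋃ i, f i, MeasurableSet.iUnion h⟩ - v ⟨⋃ i ≥ n, f i, hT n⟩ := by
      intro n
      induction n with
      | zero => simp
      | succ n ih =>
        have h1 : (⟨⋃ i ≥ n, f i, hT n⟩ : {A : Set Ω // MeasurableSet A}) =
            ⟨f n ∪ ⋃ i ≥ n + 1, f i, (h n).union (hT (n + 1))⟩ := by
          refine Subtype.ext (Set.ext fun x => ?_)
          simp only [Set.mem_iUnion, Set.mem_union, exists_prop]
          constructor
          · rintro ⟨i, hi, hx⟩
            rcases Nat.eq_or_lt_of_le hi with rfl | hi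
            · exact Or.inl hx
            · exact Or.inr ⟨i, hi, hx⟩
          · rintro (hx | ⟨i, hi, hx⟩)
            · exact ⟨n, le_rfl, hx⟩
            · exact ⟨i, Nat.le_of_succ_le hi, hx⟩
        have h2 := hadd (f n) (⋃ i ≥ n + 1, f i) (h n) (hT (n + 1)) (by
          rw [Set.disjoint_iUnion₂_right]
          exact fun i hi => hd (show n ≠ i by omega))
        rw [Finset.sum_range_succ, ih, h1, h2]
        ring
    simp only [hpart]
    simpa using tendsto_const_nhds.sub htail
  let m : Measure Ω := Measure.ofMeasurable (fun A hA => ENNReal.ofReal (v ⟨A, hA⟩))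
    (by
      have : (⟨∅, MeasurableSet.empty⟩ : {A : Set Ω // MeasurableSet A}) = ⊥ := rfl
      simp only [this, hbot, ENNReal.ofReal_zero])
    (fun f h hd => by
      rw [← (hsum h hd).tsum_eq, ENNReal.ofReal_tsum_of_nonneg (fun _ => hnn _) (hsum h hd).summable])
  have hm : ∀ A (hA : MeasurableSet A), m A = ENNReal.ofReal (v ⟨A, hA⟩) := fun A hA =>
    Measure.ofMeasurable_apply A hA
  refine ⟨⟨m, ⟨?_⟩⟩, fun A hA => ?_⟩
  · rw [hm _ MeasurableSet.univ]
    have : (⟨Set.univ, MeasurableSet.univ⟩ : {A : Set Ω // MeasurableSet A}) = ⊤ := rfl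
    rw [this, htop, ENNReal.ofReal_one]
  · show (m A).toReal = _
    rw [hm A hA, ENNReal.toReal_ofReal (hnn _)]

/-! ### Upper probabilities, weak* compactness and attainment on chains -/

section UpperProbability

variable {Ω : Type*} [MeasurableSpace Ω] {𝒬 : Set (ProbabilityMeasure Ω)}

theorem bddAbove_image_real (𝒬 : Set (ProbabilityMeasure Ω)) (A : Set Ω) :
    BddAbove ((fun P : ProbabilityMeasure Ω => (P : Measure Ω).real A) '' 𝒬) := by
  refine ⟨1, ?_⟩
  rintro _ ⟨P, -, rfl⟩
  exact measureReal_le_one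

theorem le_upperProb {P : ProbabilityMeasure Ω} (hP : P ∈ 𝒬) (A : Set Ω) :
    (P : Measure Ω).real A ≤ upperProb 𝒬 A :=
  le_csSup (bddAbove_image_real 𝒬 A) ⟨P, hP, rfl⟩

theorem upperProb_le {A : Set Ω} {t : ℝ} (ht : 0 ≤ t)
    (h : ∀ P ∈ 𝒬, (P : Measure Ω).real A ≤ t) : upperProb 𝒬 A ≤ t := by
  refine Real.sSup_le ?_ ht
  rintro _ ⟨P, hP, rfl⟩
  exact h P hP

theorem upperProb_nonneg (A : Set Ω) : 0 ≤ upperProb 𝒬 A := by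
  refine Real.sSup_nonneg ?_
  rintro _ ⟨P, hP, rfl⟩
  exact measureReal_nonneg

theorem upperProb_mono {A B : Set Ω} (h : A ⊆ B) : upperProb 𝒬 A ≤ upperProb 𝒬 B :=
  upperProb_le (upperProb_nonneg B) fun _ hP => (measureReal_mono h).trans (le_upperProb hP B)

theorem upperProb_empty : upperProb 𝒬 ∅ = 0 :=
  le_antisymm (upperProb_le le_rfl fun _ _ => by simp) (upperProb_nonneg ∅)

theorem upperProb_le_one (A : Set Ω) : upperProb 𝒬 A ≤ 1 :=
  upperProb_le zero_le_one fun _ _ => measureReal_le_one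

theorem upperProb_univ (h : (upperCore (upperProb 𝒬)).Nonempty) :
    upperProb 𝒬 Set.univ = 1 := by
  obtain ⟨P, hP⟩ := h
  refine le_antisymm (upperProb_le_one _) ?_
  simpa using hP Set.univ MeasurableSet.univ

theorem subset_upperCore : 𝒬 ⊆ upperCore (upperProb 𝒬) := fun _ hP A _ => le_upperProb hP A

theorem FinAddProb.isInducing_toFun :
    Topology.IsInducing (FinAddProb.toFun : FinAddProb Ω → _) := ⟨rfl⟩

theorem FinAddProb.toFun_le_one (Q : FinAddProb Ω) (A : {A : Set Ω // MeasurableSet A}) :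
    Q.toFun A ≤ 1 := by
  have h := Q.union' A ⟨A.1ᶜ, A.2.compl⟩ disjoint_compl_right
  have h' : Q.toFun ⟨A.1 ∪ A.1ᶜ, A.2.union A.2.compl⟩ = 1 := by
    rw [← Q.univ']
    exact congrArg _ (Subtype.ext (Set.union_compl_self A.1))
  linarith [Q.nonneg' ⟨A.1ᶜ, A.2.compl⟩]

/-- Tychonoff: the defining conditions are closed in the product of copies of `[0, 1]`, and the
topology is induced from that product. -/
instance : CompactSpace (FinAddProb Ω) := by
  refine ⟨(FinAddProb.isInducing_toFun.isCompact_iff).2 ?_⟩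
  refine (isCompact_univ_pi fun _ : {A : Set Ω // MeasurableSet A} =>
    isCompact_Icc (a := (0 : ℝ)) (b := 1)).of_isClosed_subset ?_ ?_
  · have : FinAddProb.toFun '' (Set.univ : Set (FinAddProb Ω)) =
        (⋂ A, {f | 0 ≤ f A}) ∩ {f | f ⟨Set.univ, MeasurableSet.univ⟩ = 1} ∩
          ⋂ A, ⋂ B, ⋂ _ : Disjoint A.1 B.1, {f | f ⟨A.1 ∪ B.1, A.2.union B.2⟩ = f A + f B} := by
      ext f
      simp only [Set.image_univ, Set.mem_range, Set.mem_inter_iff, Set.mem_iInter,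
        Set.mem_ofPred_eq]
      constructor
      · rintro ⟨Q, rfl⟩
        exact ⟨⟨Q.nonneg', Q.univ'⟩, Q.union'⟩
      · rintro ⟨⟨h1, h2⟩, h3⟩
        exact ⟨⟨f, h1, h2, h3⟩, rfl⟩
    rw [this]
    refine IsClosed.inter (IsClosed.inter (isClosed_iInter fun A => ?_) ?_)
      (isClosed_iInter fun A => isClosed_iInter fun B => isClosed_iInter fun _ => ?_)
    · exact isClosed_le continuous_const (continuous_apply A)
    · exact isClosed_eq (continuous_apply _) continuous_const
    · exact isClosed_eq (continuous_apply _) (by fun_prop)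
  · rintro _ ⟨Q, -, rfl⟩ A -
    exact ⟨Q.nonneg' A, Q.toFun_le_one A⟩

open Filter Topology in
/-- A weak*-closed core makes the upper probability continuous at `∅`. -/
theorem tendsto_upperProb_of_weakStarClosed (hcl : WeakStarClosed (upperCore (upperProb 𝒬)))
    (A : ℕ → Set Ω) (hA : ∀ n, MeasurableSet (A n)) (hanti : Antitone A) (hinter : ⋂ n, A n = ∅) :
    Tendsto (fun n => upperProb 𝒬 (A n)) atTop (𝓝 0) := by
  rw [Metric.tendsto_atTop]
  by_contra! hcon
  obtain ⟨ε, hε, hcon⟩ := hcon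
  have hbig : ∀ n, ε ≤ upperProb 𝒬 (A n) := by
    intro n
    obtain ⟨k, hk, hk'⟩ := hcon n
    rw [Real.dist_eq, sub_zero, abs_of_nonneg (upperProb_nonneg _)] at hk'
    exact hk'.trans (upperProb_mono (hanti hk))
  -- These sets are closed and nested. The margin `ε / 2` makes them nonempty even if the supremum
  -- is not attained. A common point lies in the core, so it is countably additive, yet it gives
  -- every `A n` mass at least `ε / 2`.
  let K : ℕ → Set (FinAddProb Ω) := fun n =>
    FinAddProb.ofProbabilityMeasure '' upperCore (upperProb 𝒬) ∩
      {Q | ε / 2 ≤ Q.toFun ⟨A n, hA n⟩}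
  have hKcl : ∀ n, IsClosed (K n) := fun n =>
    hcl.inter (isClosed_le continuous_const
      ((continuous_apply _).comp FinAddProb.isInducing_toFun.continuous))
  obtain ⟨Q, hQ⟩ := IsCompact.nonempty_iInter_of_sequence_nonempty_isCompact_isClosed K
    (by
      rintro n Q ⟨hQ, hQ'⟩
      obtain ⟨P, hP, rfl⟩ := hQ
      have h : (P : Measure Ω).real (A (n + 1)) ≤ (P : Measure Ω).real (A n) :=
        measureReal_mono (hanti n.le_succ)
      exact ⟨⟨P, hP, rfl⟩, show ε / 2 ≤ (P : Measure Ω).real (A n) from le_trans hQ' h⟩)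
    (by
      intro n
      obtain ⟨_, ⟨P, hP, rfl⟩, hlt⟩ : ∃ t ∈ (fun P : ProbabilityMeasure Ω =>
          (P : Measure Ω).real (A n)) '' 𝒬, ε / 2 < t := by
        refine exists_lt_of_lt_csSup ?_ (lt_of_lt_of_le (half_lt_self hε) (hbig n))
        by_contra hne
        rw [Set.not_nonempty_iff_eq_empty] at hne
        have := hbig n
        rw [upperProb, hne, Real.sSup_empty] at this
        linarith
      exact ⟨_, ⟨P, subset_upperCore hP, rfl⟩, hlt.le⟩)
    (hKcl 0).isCompact hKcl
  rw [Set.mem_iInter] at hQ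
  obtain ⟨P, hP, rfl⟩ := (hQ 0).1
  have hlim : Tendsto (fun n => (P : Measure Ω).real (A n)) atTop (𝓝 0) := by
    have h := tendsto_measure_iInter_atTop (μ := (P : Measure Ω))
      (fun n => (hA n).nullMeasurableSet) hanti ⟨0, measure_ne_top _ _⟩
    rw [hinter, measure_empty] at h
    exact (ENNReal.tendsto_toReal ENNReal.zero_ne_top).comp h
  have := ge_of_tendsto' hlim fun n => (hQ n).2
  linarith

/-- If the upper probability is concave and its core is nonempty and weak*-closed, then some
element of the core attains the upper probability along a given chain of events. -/
theorem exists_mem_upperCore_eq_of_isChain (hne : (upperCore (upperProb 𝒬)).Nonempty)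
    (hcl : WeakStarClosed (upperCore (upperProb 𝒬))) (hconc : TwoAlternating (upperProb 𝒬))
    (c : Set (Set Ω)) (hc : IsChain (· ⊆ ·) c) (hmeas : ∀ A ∈ c, MeasurableSet A) :
    ∃ P ∈ upperCore (upperProb 𝒬), ∀ A ∈ c, (P : Measure Ω).real A = upperProb 𝒬 A := by
  -- Adjoining `⊥` and `⊤` fixes the values of the modular minorant there at 0 and 1.
  let c' : Set {A : Set Ω // MeasurableSet A} := insert ⊤ (insert ⊥ {A | A.1 ∈ c})
  have hc' : IsChain (· ≤ ·) c' := by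
    refine IsChain.insert (IsChain.insert ?_ fun _ _ _ => Or.inl bot_le)
      fun _ _ _ => Or.inr le_top
    intro A hA B hB hAB
    exact hc hA hB fun h => hAB (Subtype.ext h)
  obtain ⟨v, hmono, hle, hvc, hmod⟩ := exists_modular_le_of_isChain
    (fun A : {A : Set Ω // MeasurableSet A} => upperProb 𝒬 A.1)
    (fun A B h => upperProb_mono h)
    (fun A B => by
      have h := hconc A.1 B.1 A.2 B.2
      show upperProb 𝒬 (A.1 ∪ B.1) + upperProb 𝒬 (A.1 ∩ B.1) ≤ _
      linarith) c' hc' (Or.inr (Or.inl rfl))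
  have hbot : v ⊥ = 0 := (hvc ⊥ (Or.inr (Or.inl rfl))).trans upperProb_empty
  have htop : v ⊤ = 1 := (hvc ⊤ (Or.inl rfl)).trans (upperProb_univ hne)
  obtain ⟨P, hP⟩ := exists_probabilityMeasure_of_modular v hbot htop hmono hmod
    (fun A hA hanti hinter => squeeze_zero (fun n => hbot ▸ hmono bot_le)
      (fun n => hle ⟨A n, hA n⟩) (tendsto_upperProb_of_weakStarClosed hcl A hA hanti hinter))
  refine ⟨P, fun A hA => (hP A hA).trans_le (hle ⟨A, hA⟩), fun A hA => ?_⟩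
  rw [hP A (hmeas A hA)]
  exact hvc _ (Or.inr (Or.inr hA))

end UpperProbability

/-! ### Submodularity of a ratio -/

noncomputable section

/-- Compare the increment from `b` to `c` with that from `d` to `a`. Over common denominators the
first has the larger denominator, and `hcross` is what remains to be checked for the numerators once
sub- and supermodularity are used. Exchanging `a` and `b` reverses `hcross`, so it holds in one of
the two orders. -/
theorem div_add_sub_le_of_mul_le {xa xb xc xd za zb zc zd : ℝ} (hxd : 0 ≤ xd) (hzd : 0 < xd + zd)
    (hzb : 0 ≤ zb) (hxda : xd ≤ xa) (hxdb : xd ≤ xb) (hx : xc + xd ≤ xa + xb)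
    (hzad : za ≤ zd) (hz : za + zb ≤ zc + zd)
    (hdb : xd + zd ≤ xb + zb) (hda : xd + zd ≤ xa + za) (hac : xa + za ≤ xc + zc)
    (hzd0 : 0 ≤ zd) (hcross : (zd - za) * (xb - xd) ≤ (xa - xd) * (zd - zb)) :
    xc / (xc + zc) + xd / (xd + zd) ≤ xa / (xa + za) + xb / (xb + zb) := by
  have hna : 0 < xa + za := by linarith
  have hnb : 0 < xb + zb := by linarith
  have hnc : 0 < xc + zc := by linarith
  have h1 : xc / (xc + zc) - xb / (xb + zb) =
      ((xc - xb) * zb + xb * (zb - zc)) / ((xc + zc) * (xb + zb)) := by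
    field_simp
    ring
  have h2 : xa / (xa + za) - xd / (xd + zd) =
      ((xa - xd) * zd + xd * (zd - za)) / ((xa + za) * (xd + zd)) := by
    field_simp
    ring
  have hnum : (xc - xb) * zb + xb * (zb - zc) ≤ (xa - xd) * zd + xd * (zd - za) := by
    have h3 : (xc - xb) * zb ≤ (xa - xd) * zb := mul_le_mul_of_nonneg_right (by linarith) hzb
    have h4 : xb * (zb - zc) ≤ xb * (zd - za) :=
      mul_le_mul_of_nonneg_left (by linarith) (by linarith)
    nlinarith
  have hnn : 0 ≤ (xa - xd) * zd + xd * (zd - za) :=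
    add_nonneg (mul_nonneg (by linarith) hzd0) (mul_nonneg hxd (by linarith))
  have h5 : xc / (xc + zc) - xb / (xb + zb) ≤ xa / (xa + za) - xd / (xd + zd) := by
    rw [h1, h2]
    exact div_le_div₀ hnn hnum (mul_pos hna hzd) (mul_le_mul hac hdb hzd.le hnc.le)
  linarith

/-- If `x` is submodular and increasing, `z` supermodular and decreasing, and `x + z` increasing,
then `x / (x + z)` is submodular; here `d`, `a`, `b`, `c` stand for the values at
`A ∩ B`, `A`, `B`, `A ∪ B`. -/
theorem div_add_submodular {xa xb xc xd za zb zc zd : ℝ} (hxd : 0 ≤ xd)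
    (hzc : 0 ≤ zc) (hxda : xd ≤ xa) (hxdb : xd ≤ xb) (hxac : xa ≤ xc)
    (hx : xc + xd ≤ xa + xb) (hzad : za ≤ zd) (hzbd : zb ≤ zd) (hzca : zc ≤ za) (hzcb : zc ≤ zb)
    (hz : za + zb ≤ zc + zd) (hda : xd + zd ≤ xa + za) (hdb : xd + zd ≤ xb + zb)
    (hac : xa + za ≤ xc + zc) (hbc : xb + zb ≤ xc + zc) :
    xc / (xc + zc) + xd / (xd + zd) ≤ xa / (xa + za) + xb / (xb + zb) := by
  have hxa : 0 ≤ xa := hxd.trans hxda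
  have hxb : 0 ≤ xb := hxd.trans hxdb
  have hza : 0 ≤ za := hzc.trans hzca
  have hzb : 0 ≤ zb := hzc.trans hzcb
  have hzd : 0 ≤ zd := hza.trans hzad
  -- If the smallest denominator vanishes, all `z` values do, and each ratio is 1, or 0 by the
  -- convention `0 / 0 = 0`.
  rcases (add_nonneg hxd hzd).eq_or_lt with h0 | hpos
  · have hd0 : xd = 0 := by linarith
    have hzd0 : zd = 0 := by linarith
    have hza0 : za = 0 := by linarith
    have hzb0 : zb = 0 := by linarith
    have hzc0 : zc = 0 := by linarith
    subst hd0 hzd0 hza0 hzb0 hzc0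
    simp only [add_zero, div_zero]
    rcases eq_or_ne xa 0 with rfl | ha
    · rcases eq_or_ne xb 0 with rfl | hb
      · have : xc = 0 := by linarith
        simp [this]
      · rw [div_self hb]
        linarith [div_self_le_one xc, zero_div (0 : ℝ)]
    · rw [div_self ha]
      linarith [div_self_le_one xc, div_nonneg hxb hxb]
  · rcases le_total ((zd - za) * (xb - xd)) ((xa - xd) * (zd - zb)) with h | h
    · exact div_add_sub_le_of_mul_le hxd hpos hzb hxda hxdb hx hzad hz hdb hda hac hzd h
    · rw [add_comm (xa / _)]
      exact div_add_sub_le_of_mul_le hxd hpos hza hxdb hxda (by linarith) hzbd (by linarith)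
        hda hdb hbc hzd (by linarith)

/-- Increasing the numerator part and decreasing the remaining part increases the ratio. -/
theorem div_add_le_div_add {i j x z : ℝ} (hi : 0 ≤ i) (hz : 0 ≤ z) (hix : i ≤ x) (hzj : z ≤ j) :
    i / (i + j) ≤ x / (x + z) := by
  rcases hi.eq_or_lt with rfl | hi
  · rw [zero_div]
    exact div_nonneg hix (add_nonneg hix hz)
  · rw [div_le_div_iff₀ (by linarith) (by linarith)]
    nlinarith [mul_le_mul hix hzj hz (hi.le.trans hix)]

/-! ### Choquet integrals by layers -/

section Layers

variable {Θ : Type*} [MeasurableSpace Θ]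

theorem setIntegral_eq_integral_layers (P : ProbabilityMeasure Θ) {f : Θ → ℝ} {M : ℝ}
    (hf : Measurable f) (h0 : ∀ θ, 0 ≤ f θ) (hM : ∀ θ, f θ ≤ M) {A : Set Θ} :
    ∫ θ in A, f θ ∂(P : Measure Θ) =
      ∫ s in Set.Ioc 0 M, (P : Measure Θ).real (A ∩ {θ | s ≤ f θ}) := by
  rw [Integrable.integral_eq_integral_Ioc_meas_le (M := M)]
  · refine setIntegral_congr_fun measurableSet_Ioc fun s _ => ?_
    rw [measureReal_restrict_apply (measurableSet_le measurable_const hf), Set.inter_comm]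
  · refine Integrable.of_bound hf.aestronglyMeasurable M (.of_forall fun θ => ?_)
    rw [Real.norm_of_nonneg (h0 θ)]
    exact hM θ
  · exact .of_forall h0
  · exact .of_forall hM

theorem integrableOn_Ioc_of_antitone {g : ℝ → ℝ} (hg : Antitone g) (M : ℝ) :
    IntegrableOn g (Set.Ioc 0 M) :=
  ((hg.antitoneOn _).integrableOn_isCompact isCompact_Icc).mono_set Set.Ioc_subset_Icc_self

/-- The Choquet integral of `1_A U` with respect to `u`, for `0 ≤ U ≤ M`. -/
def upperLayerIntegral (u : Set Θ → ℝ) (U : Θ → ℝ) (M : ℝ) (A : Set Θ) : ℝ :=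
  ∫ s in Set.Ioc 0 M, u (A ∩ {θ | s ≤ U θ})

/-- The Choquet integral of `1_{Aᶜ} l` with respect to the conjugate of `u`, for `0 ≤ l ≤ M`. -/
def lowerLayerIntegral (u : Set Θ → ℝ) (l : Θ → ℝ) (M : ℝ) (A : Set Θ) : ℝ :=
  ∫ s in Set.Ioc 0 M, (1 - u (A ∪ {θ | l θ < s}))

variable {u : Set Θ → ℝ} {U l : Θ → ℝ} {M : ℝ}

theorem integrableOn_upperLayer {Θ : Type*} {u : Set Θ → ℝ} (hu : Monotone u) (U : Θ → ℝ) (M : ℝ)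
    (A : Set Θ) :
    IntegrableOn (fun s => u (A ∩ {θ | s ≤ U θ})) (Set.Ioc 0 M) :=
  integrableOn_Ioc_of_antitone (fun _ _ hst =>
    hu (Set.inter_subset_inter_right A fun θ (hθ : _ ≤ U θ) => hst.trans hθ)) M

theorem integrableOn_lowerLayer {Θ : Type*} {u : Set Θ → ℝ} (hu : Monotone u) (l : Θ → ℝ) (M : ℝ)
    (A : Set Θ) :
    IntegrableOn (fun s => 1 - u (A ∪ {θ | l θ < s})) (Set.Ioc 0 M) :=
  integrableOn_Ioc_of_antitone (fun _ _ hst => sub_le_sub_left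
    (hu (Set.union_subset_union_right A fun θ (hθ : l θ < _) => lt_of_lt_of_le hθ hst)) 1) M

theorem upperLayerIntegral_mono {Θ : Type*} {u : Set Θ → ℝ} {U : Θ → ℝ} (hu : Monotone u)
    {A B : Set Θ} (h : A ⊆ B) :
    upperLayerIntegral u U M A ≤ upperLayerIntegral u U M B :=
  setIntegral_mono (integrableOn_upperLayer hu U M A) (integrableOn_upperLayer hu U M B)
    fun _ => hu (Set.inter_subset_inter_left _ h)

theorem lowerLayerIntegral_anti {Θ : Type*} {u : Set Θ → ℝ} {l : Θ → ℝ} (hu : Monotone u)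
    {A B : Set Θ} (h : A ⊆ B) :
    lowerLayerIntegral u l M B ≤ lowerLayerIntegral u l M A :=
  setIntegral_mono (integrableOn_lowerLayer hu l M B) (integrableOn_lowerLayer hu l M A)
    fun _ => sub_le_sub_left (hu (Set.union_subset_union_left _ h)) 1

/-- Concavity applies layer by layer, since cutting with a level set commutes with unions and
intersections. -/
theorem upperLayerIntegral_submodular (hu : Monotone u) (hc : TwoAlternating u)
    (hU : Measurable U) {A B : Set Θ} (hA : MeasurableSet A) (hB : MeasurableSet B) :
    upperLayerIntegral u U M (A ∪ B) + upperLayerIntegral u U M (A ∩ B) ≤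
      upperLayerIntegral u U M A + upperLayerIntegral u U M B := by
  unfold upperLayerIntegral
  rw [← integral_add (integrableOn_upperLayer hu U M _) (integrableOn_upperLayer hu U M _),
    ← integral_add (integrableOn_upperLayer hu U M _) (integrableOn_upperLayer hu U M _)]
  refine setIntegral_mono
    ((integrableOn_upperLayer hu U M _).add (integrableOn_upperLayer hu U M _))
    ((integrableOn_upperLayer hu U M _).add (integrableOn_upperLayer hu U M _)) fun s => ?_
  have hs : MeasurableSet {θ | s ≤ U θ} := measurableSet_le measurable_const hU
  have h := hc _ _ (hA.inter hs) (hB.inter hs)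
  rw [← Set.union_inter_distrib_right, ← Set.inter_inter_distrib_right] at h
  dsimp only
  linarith

theorem lowerLayerIntegral_supermodular (hu : Monotone u) (hc : TwoAlternating u)
    (hl : Measurable l) {A B : Set Θ} (hA : MeasurableSet A) (hB : MeasurableSet B) :
    lowerLayerIntegral u l M A + lowerLayerIntegral u l M B ≤
      lowerLayerIntegral u l M (A ∪ B) + lowerLayerIntegral u l M (A ∩ B) := by
  unfold lowerLayerIntegral
  rw [← integral_add (integrableOn_lowerLayer hu l M _) (integrableOn_lowerLayer hu l M _),
    ← integral_add (integrableOn_lowerLayer hu l M _) (integrableOn_lowerLayer hu l M _)]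
  refine setIntegral_mono
    ((integrableOn_lowerLayer hu l M _).add (integrableOn_lowerLayer hu l M _))
    ((integrableOn_lowerLayer hu l M _).add (integrableOn_lowerLayer hu l M _)) fun s => ?_
  have hs : MeasurableSet {θ | l θ < s} := measurableSet_lt hl measurable_const
  have h := hc _ _ (hA.union hs) (hB.union hs)
  rw [← Set.union_union_distrib_right, ← Set.inter_union_distrib_right] at h
  dsimp only
  linarith

/-- At each level, apply concavity to `B ∩ {s ≤ U}` and `A ∪ {l < s}`. Since `l ≤ U`, the sets `{s ≤
U}` and `{l < s}` cover `Θ`, so the union contains `B ∪ {l < s}`; the intersection contains `A ∩ {s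
≤ U}`. -/
theorem upperLayerIntegral_add_lowerLayerIntegral_mono (hu : Monotone u) (hc : TwoAlternating u)
    (hU : Measurable U) (hl : Measurable l) (hlU : l ≤ U) {A B : Set Θ} (hA : MeasurableSet A)
    (hB : MeasurableSet B) (hAB : A ⊆ B) :
    upperLayerIntegral u U M A + lowerLayerIntegral u l M A ≤
      upperLayerIntegral u U M B + lowerLayerIntegral u l M B := by
  unfold upperLayerIntegral lowerLayerIntegral
  rw [← integral_add (integrableOn_upperLayer hu U M _) (integrableOn_lowerLayer hu l M _),
    ← integral_add (integrableOn_upperLayer hu U M _) (integrableOn_lowerLayer hu l M _)]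
  refine setIntegral_mono
    ((integrableOn_upperLayer hu U M _).add (integrableOn_lowerLayer hu l M _))
    ((integrableOn_upperLayer hu U M _).add (integrableOn_lowerLayer hu l M _)) fun s => ?_
  have h := hc _ _ (hB.inter (measurableSet_le measurable_const hU : MeasurableSet {θ | s ≤ U θ}))
    (hA.union (measurableSet_lt hl measurable_const : MeasurableSet {θ | l θ < s}))
  have h1 : u (B ∪ {θ | l θ < s}) ≤ u (B ∩ {θ | s ≤ U θ} ∪ (A ∪ {θ | l θ < s})) := by
    refine hu ?_
    rintro θ (hθ | hθ)
    · rcases le_or_gt s (U θ) with h | h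
      · exact Or.inl ⟨hθ, h⟩
      · exact Or.inr (Or.inr (lt_of_le_of_lt (hlU θ) h))
    · exact Or.inr (Or.inr hθ)
  have h2 : u (A ∩ {θ | s ≤ U θ}) ≤ u (B ∩ {θ | s ≤ U θ} ∩ (A ∪ {θ | l θ < s})) :=
    hu fun θ hθ => ⟨⟨hAB hθ.1, hθ.2⟩, Or.inl hθ.1⟩
  dsimp only
  linarith

theorem setIntegral_compl_eq_integral_layers (P : ProbabilityMeasure Θ)
    (hl : Measurable l) (h0 : ∀ θ, 0 ≤ l θ) (hM : ∀ θ, l θ ≤ M) {A : Set Θ}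
    (hA : MeasurableSet A) :
    ∫ θ in Aᶜ, l θ ∂(P : Measure Θ) = lowerLayerIntegral (P : Measure Θ).real l M A := by
  rw [setIntegral_eq_integral_layers P hl h0 hM]
  refine setIntegral_congr_fun measurableSet_Ioc fun s _ => ?_
  rw [← probReal_compl_eq_one_sub (hA.union (measurableSet_lt hl measurable_const)),
    Set.compl_union]
  congr 2
  ext θ
  simp

theorem monotone_measureReal (P : ProbabilityMeasure Θ) : Monotone (P : Measure Θ).real :=
  fun _ _ h => measureReal_mono h

theorem setIntegral_le_upperLayerIntegral (hu : Monotone u) {P : ProbabilityMeasure Θ}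
    (hP : P ∈ upperCore u) (hU : Measurable U) (h0 : ∀ θ, 0 ≤ U θ) (hM : ∀ θ, U θ ≤ M)
    {A : Set Θ} (hA : MeasurableSet A) :
    ∫ θ in A, U θ ∂(P : Measure Θ) ≤ upperLayerIntegral u U M A := by
  rw [setIntegral_eq_integral_layers P hU h0 hM]
  exact setIntegral_mono (integrableOn_upperLayer (monotone_measureReal P) U M A)
    (integrableOn_upperLayer hu U M A)
    fun s => hP _ (hA.inter (measurableSet_le measurable_const hU))

theorem lowerLayerIntegral_le_setIntegral (hu : Monotone u) {P : ProbabilityMeasure Θ}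
    (hP : P ∈ upperCore u) (hl : Measurable l) (h0 : ∀ θ, 0 ≤ l θ) (hM : ∀ θ, l θ ≤ M)
    {A : Set Θ} (hA : MeasurableSet A) :
    lowerLayerIntegral u l M A ≤ ∫ θ in Aᶜ, l θ ∂(P : Measure Θ) := by
  rw [setIntegral_compl_eq_integral_layers P hl h0 hM hA]
  exact setIntegral_mono (integrableOn_lowerLayer hu l M A)
    (integrableOn_lowerLayer (monotone_measureReal P) l M A)
    fun s => sub_le_sub_left (hP _ (hA.union (measurableSet_lt hl measurable_const))) 1

/-- A single prior in the core attains both layer integrals. -/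
theorem exists_mem_upperCore_eq_layerIntegrals {𝒬 : Set (ProbabilityMeasure Θ)}
    (hne : (upperCore (upperProb 𝒬)).Nonempty) (hcl : WeakStarClosed (upperCore (upperProb 𝒬)))
    (hconc : TwoAlternating (upperProb 𝒬)) (hU : Measurable U) (hl : Measurable l)
    (hU0 : ∀ θ, 0 ≤ U θ) (hl0 : ∀ θ, 0 ≤ l θ) (hUM : ∀ θ, U θ ≤ M) (hlM : ∀ θ, l θ ≤ M)
    {A : Set Θ} (hA : MeasurableSet A) :
    ∃ P ∈ upperCore (upperProb 𝒬),
      ∫ θ in A, U θ ∂(P : Measure Θ) = upperLayerIntegral (upperProb 𝒬) U M A ∧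
      ∫ θ in Aᶜ, l θ ∂(P : Measure Θ) = lowerLayerIntegral (upperProb 𝒬) l M A := by
  -- The layers of `U` lie inside `A` and those of `l` contain `A`, so the two families form a
  -- single chain and one prior serves both.
  let c : Set (Set Θ) := Set.range (fun s : ℝ => A ∩ {θ | s ≤ U θ}) ∪
    Set.range (fun s : ℝ => A ∪ {θ | l θ < s})
  have hc : IsChain (· ⊆ ·) c := by
    rintro _ (⟨s, rfl⟩ | ⟨s, rfl⟩) _ (⟨t, rfl⟩ | ⟨t, rfl⟩) -
    · rcases le_total s t with h | h
      · exact Or.inr (Set.inter_subset_inter_right A fun _ hθ => h.trans hθ)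
      · exact Or.inl (Set.inter_subset_inter_right A fun _ hθ => h.trans hθ)
    · exact Or.inl (Set.inter_subset_left.trans Set.subset_union_left)
    · exact Or.inr (Set.inter_subset_left.trans Set.subset_union_left)
    · rcases le_total s t with h | h
      · exact Or.inl (Set.union_subset_union_right A fun _ hθ => lt_of_lt_of_le hθ h)
      · exact Or.inr (Set.union_subset_union_right A fun _ hθ => lt_of_lt_of_le hθ h)
  obtain ⟨P, hP, hPc⟩ := exists_mem_upperCore_eq_of_isChain hne hcl hconc c hc (by
    rintro _ (⟨s, rfl⟩ | ⟨s, rfl⟩)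
    · exact hA.inter (measurableSet_le measurable_const hU)
    · exact hA.union (measurableSet_lt hl measurable_const))
  refine ⟨P, hP, ?_, ?_⟩
  · rw [setIntegral_eq_integral_layers P hU hU0 hUM]
    exact setIntegral_congr_fun measurableSet_Ioc fun s _ => hPc _ (Or.inl ⟨s, rfl⟩)
  · rw [setIntegral_compl_eq_integral_layers P hl hl0 hlM hA]
    exact setIntegral_congr_fun measurableSet_Ioc fun s _ =>
      congrArg (fun t => 1 - t) (hPc _ (Or.inr ⟨s, rfl⟩))

end Layers

/-! ### Bounds for posteriors and preservation of concavity -/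

section Posterior

variable {Θ : Type*} [MeasurableSpace Θ] {μ : Measure Θ}

theorem integrable_of_mem_boundedNonnegMeasurable (P : ProbabilityMeasure Θ) {L : Θ → ℝ}
    (hL : L ∈ boundedNonnegMeasurable Θ) : Integrable L (P : Measure Θ) := by
  obtain ⟨hm, h0, M, hM⟩ := hL
  refine Integrable.of_bound hm.aestronglyMeasurable M (.of_forall fun θ => ?_)
  rw [Real.norm_of_nonneg (h0 θ)]
  exact hM θ

theorem setLIntegral_ofReal_mul_density {P : ProbabilityMeasure Θ} {p : Θ → ℝ≥0∞}
    (hp : Measurable p) (hP : (P : Measure Θ) = μ.withDensity p) {L : Θ → ℝ}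
    (hL : L ∈ boundedNonnegMeasurable Θ) {A : Set Θ} (hA : MeasurableSet A) :
    ∫⁻ θ in A, ENNReal.ofReal (L θ) * p θ ∂μ =
      ENNReal.ofReal (∫ θ in A, L θ ∂(P : Measure Θ)) := by
  rw [ofReal_integral_eq_lintegral_ofReal
    (integrable_of_mem_boundedNonnegMeasurable P hL).integrableOn (.of_forall hL.2.1), hP,
    setLIntegral_withDensity_eq_setLIntegral_mul μ hp hL.1.ennreal_ofReal hA]
  simp only [Pi.mul_apply, mul_comm]

theorem lintegral_ofReal_mul_density {P : ProbabilityMeasure Θ} {p : Θ → ℝ≥0∞}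
    (hp : Measurable p) (hP : (P : Measure Θ) = μ.withDensity p) {L : Θ → ℝ}
    (hL : L ∈ boundedNonnegMeasurable Θ) :
    ∫⁻ θ, ENNReal.ofReal (L θ) * p θ ∂μ = ENNReal.ofReal (∫ θ, L θ ∂(P : Measure Θ)) := by
  simpa using setLIntegral_ofReal_mul_density hp hP hL MeasurableSet.univ

theorem withDensity_posterior_apply {P : ProbabilityMeasure Θ} {p : Θ → ℝ≥0∞}
    (hp : Measurable p) (hP : (P : Measure Θ) = μ.withDensity p) {L : Θ → ℝ}
    (hL : L ∈ boundedNonnegMeasurable Θ) (hpos : 0 < ∫ θ, L θ ∂(P : Measure Θ))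
    {A : Set Θ} (hA : MeasurableSet A) :
    μ.withDensity (fun θ => ENNReal.ofReal (L θ) * p θ /
        ∫⁻ θ', ENNReal.ofReal (L θ') * p θ' ∂μ) A =
      ENNReal.ofReal ((∫ θ in A, L θ ∂(P : Measure Θ)) / ∫ θ, L θ ∂(P : Measure Θ)) := by
  rw [withDensity_apply _ hA, lintegral_ofReal_mul_density hp hP hL]
  simp only [div_eq_mul_inv]
  rw [lintegral_mul_const _ (hL.1.ennreal_ofReal.fun_mul hp),
    setLIntegral_ofReal_mul_density hp hP hL hA, ← div_eq_mul_inv, ← div_eq_mul_inv,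
    ENNReal.ofReal_div_of_pos hpos]

theorem exists_of_mem_posteriorClass {C : Set (ProbabilityMeasure Θ)} {𝓛 : Set (Θ → ℝ)}
    (h𝓛 : 𝓛 ⊆ boundedNonnegMeasurable Θ) {Q : ProbabilityMeasure Θ}
    (hQ : Q ∈ posteriorClass μ C 𝓛) :
    ∃ P ∈ C, ∃ L ∈ 𝓛, ∀ A, MeasurableSet A → (Q : Measure Θ).real A =
      (∫ θ in A, L θ ∂(P : Measure Θ)) / ∫ θ, L θ ∂(P : Measure Θ) := by
  obtain ⟨P, hPC, p, hp, hP, L, hL, hpos, hQ⟩ := hQ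
  refine ⟨P, hPC, L, hL, fun A hA => ?_⟩
  rw [lintegral_ofReal_mul_density hp hP (h𝓛 hL), ENNReal.ofReal_pos] at hpos
  have h0 : 0 ≤ ∫ θ in A, L θ ∂(P : Measure Θ) := integral_nonneg (h𝓛 hL).2.1
  rw [Measure.real, hQ, withDensity_posterior_apply hp hP (h𝓛 hL) hpos hA,
    ENNReal.toReal_ofReal (div_nonneg h0 hpos.le)]

theorem exists_mem_posteriorClass [SigmaFinite μ] {C : Set (ProbabilityMeasure Θ)}
    {𝓛 : Set (Θ → ℝ)} {P : ProbabilityMeasure Θ} (hPC : P ∈ C) (hac : (P : Measure Θ) ≪ μ)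
    {L : Θ → ℝ} (hL : L ∈ 𝓛) (hLb : L ∈ boundedNonnegMeasurable Θ)
    (hpos : 0 < ∫ θ, L θ ∂(P : Measure Θ)) :
    ∃ Q ∈ posteriorClass μ C 𝓛, ∀ A, MeasurableSet A → (Q : Measure Θ).real A =
      (∫ θ in A, L θ ∂(P : Measure Θ)) / ∫ θ, L θ ∂(P : Measure Θ) := by
  have hp : Measurable ((P : Measure Θ).rnDeriv μ) := Measure.measurable_rnDeriv _ _
  have hP : (P : Measure Θ) = μ.withDensity ((P : Measure Θ).rnDeriv μ) :=
    (Measure.withDensity_rnDeriv_eq _ _ hac).symm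
  have happ := fun A (hA : MeasurableSet A) =>
    withDensity_posterior_apply hp hP hLb hpos hA
  refine ⟨⟨μ.withDensity _, ⟨?_⟩⟩, ⟨P, hPC, _, hp, hP, L, hL, ?_, rfl⟩, fun A hA => ?_⟩
  · rw [happ _ MeasurableSet.univ, setIntegral_univ, div_self hpos.ne', ENNReal.ofReal_one]
  · rw [lintegral_ofReal_mul_density hp hP hLb]
    exact ENNReal.ofReal_pos.2 hpos
  · rw [ProbabilityMeasure.coe_mk, Measure.real, happ A hA, ENNReal.toReal_ofReal]
    exact div_nonneg (integral_nonneg hLb.2.1) hpos.le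

variable {𝒬 : Set (ProbabilityMeasure Θ)} {𝓛 : Set (Θ → ℝ)}

/-- Replacing `L` by `U` on `A` and by `l` off `A`, and then `P` by the two Choquet bounds, enlarges
the numerator part and shrinks the rest. -/
theorem real_le_div_layerIntegrals (h𝓛 : 𝓛 ⊆ boundedNonnegMeasurable Θ)
    {Q : ProbabilityMeasure Θ} {P : ProbabilityMeasure Θ} (hP : P ∈ upperCore (upperProb 𝒬))
    {L : Θ → ℝ} (hL : L ∈ 𝓛) (hQ : ∀ A, MeasurableSet A → (Q : Measure Θ).real A =
      (∫ θ in A, L θ ∂(P : Measure Θ)) / ∫ θ, L θ ∂(P : Measure Θ))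
    {U l : Θ → ℝ} {M : ℝ} (hU : U ∈ 𝓛) (hl : l ∈ 𝓛) (hUM : ∀ θ, U θ ≤ M) (hlM : ∀ θ, l θ ≤ M)
    (hLU : ∀ θ, L θ ≤ U θ) (hlL : ∀ θ, l θ ≤ L θ) {A : Set Θ} (hA : MeasurableSet A) :
    (Q : Measure Θ).real A ≤ upperLayerIntegral (upperProb 𝒬) U M A /
      (upperLayerIntegral (upperProb 𝒬) U M A + lowerLayerIntegral (upperProb 𝒬) l M A) := by
  have hmono : Monotone (upperProb 𝒬) := fun _ _ => upperProb_mono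
  have hint := fun {f : Θ → ℝ} (hf : f ∈ 𝓛) =>
    integrable_of_mem_boundedNonnegMeasurable P (h𝓛 hf)
  rw [hQ A hA, ← integral_add_compl hA (hint hL)]
  refine div_add_le_div_add (integral_nonneg (h𝓛 hL).2.1)
    (integral_nonneg fun s => sub_nonneg.2 (upperProb_le_one _)) ?_ ?_
  · exact (setIntegral_mono (hint hL).integrableOn (hint hU).integrableOn hLU).trans
      (setIntegral_le_upperLayerIntegral hmono hP (h𝓛 hU).1 (h𝓛 hU).2.1 hUM hA)
  · exact (lowerLayerIntegral_le_setIntegral hmono hP (h𝓛 hl).1 (h𝓛 hl).2.1 hlM hA).trans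
      (setIntegral_mono (hint hl).integrableOn (hint hL).integrableOn hlL)

-- The bound is attained by the pasted likelihood and the prior from
-- `exists_mem_upperCore_eq_layerIntegrals`, unless the normalizing constant is zero; then the left
-- side is `0 / 0 = 0`.
open Classical in
theorem div_layerIntegrals_le_upperProb [SigmaFinite μ]
    (hac : ∀ P ∈ upperCore (upperProb 𝒬), (P : Measure Θ) ≪ μ)
    (hne : (upperCore (upperProb 𝒬)).Nonempty) (hcl : WeakStarClosed (upperCore (upperProb 𝒬)))
    (hconc : TwoAlternating (upperProb 𝒬)) (h𝓛 : 𝓛 ⊆ boundedNonnegMeasurable Θ)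
    (hpaste : ∀ L ∈ 𝓛, ∀ L' ∈ 𝓛, ∀ A, MeasurableSet A → A.piecewise L L' ∈ 𝓛)
    {U l : Θ → ℝ} {M : ℝ} (hU : U ∈ 𝓛) (hl : l ∈ 𝓛) (hUM : ∀ θ, U θ ≤ M) (hlM : ∀ θ, l θ ≤ M)
    {A : Set Θ} (hA : MeasurableSet A) :
    upperLayerIntegral (upperProb 𝒬) U M A / (upperLayerIntegral (upperProb 𝒬) U M A +
        lowerLayerIntegral (upperProb 𝒬) l M A) ≤
      upperProb (posteriorClass μ (upperCore (upperProb 𝒬)) 𝓛) A := by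
  obtain ⟨P, hP, hx, hz⟩ := exists_mem_upperCore_eq_layerIntegrals hne hcl hconc (h𝓛 hU).1
    (h𝓛 hl).1 (h𝓛 hU).2.1 (h𝓛 hl).2.1 hUM hlM hA
  have hL : A.piecewise U l ∈ 𝓛 := hpaste U hU l hl A hA
  have h1 : ∫ θ in A, A.piecewise U l θ ∂(P : Measure Θ) =
      upperLayerIntegral (upperProb 𝒬) U M A := by
    rw [← hx]
    exact setIntegral_congr_fun hA fun θ hθ => Set.piecewise_eq_of_mem _ _ _ hθ
  have h2 : ∫ θ in Aᶜ, A.piecewise U l θ ∂(P : Measure Θ) =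
      lowerLayerIntegral (upperProb 𝒬) l M A := by
    rw [← hz]
    exact setIntegral_congr_fun hA.compl fun θ hθ => Set.piecewise_eq_of_notMem _ _ _ hθ
  have h3 : ∫ θ, A.piecewise U l θ ∂(P : Measure Θ) = upperLayerIntegral (upperProb 𝒬) U M A +
      lowerLayerIntegral (upperProb 𝒬) l M A := by
    rw [← h1, ← h2]
    exact (integral_add_compl hA (integrable_of_mem_boundedNonnegMeasurable P (h𝓛 hL))).symm
  have h0 : 0 ≤ ∫ θ, A.piecewise U l θ ∂(P : Measure Θ) := integral_nonneg (h𝓛 hL).2.1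
  rw [← h3]
  rcases h0.eq_or_lt with h | h
  · rw [← h, div_zero]
    exact upperProb_nonneg A
  · obtain ⟨Q, hQ, hQA⟩ := exists_mem_posteriorClass hP (hac P hP) hL (h𝓛 hL) h
    rw [← h1, ← hQA A hA]
    exact le_upperProb hQ A

open Classical in
/-- Bayes' rule preserves concavity: if the prior upper probability is concave with nonempty
weak*-closed core, and the likelihood functions can be pasted along measurable sets, then the
upper posterior is concave. -/
theorem twoAlternating_upperProb_posteriorClass [SigmaFinite μ]
    (hac : ∀ P ∈ upperCore (upperProb 𝒬), (P : Measure Θ) ≪ μ)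
    (hne : (upperCore (upperProb 𝒬)).Nonempty) (hcl : WeakStarClosed (upperCore (upperProb 𝒬)))
    (hconc : TwoAlternating (upperProb 𝒬)) (h𝓛 : 𝓛 ⊆ boundedNonnegMeasurable Θ)
    (hpaste : ∀ L ∈ 𝓛, ∀ L' ∈ 𝓛, ∀ A, MeasurableSet A → A.piecewise L L' ∈ 𝓛) :
    TwoAlternating (upperProb (posteriorClass μ (upperCore (upperProb 𝒬)) 𝓛)) := by
  intro A B hA hB
  have hAB := hA.union hB
  have hAB' := hA.inter hB
  set R := posteriorClass μ (upperCore (upperProb 𝒬)) 𝓛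
  -- Working with pairs needs only the envelopes of two likelihoods, which stay measurable and
  -- bounded; suprema over `Q₁` and `Q₂` are taken afterwards.
  have key : ∀ Q₁ ∈ R, ∀ Q₂ ∈ R, (Q₁ : Measure Θ).real (A ∪ B) + (Q₂ : Measure Θ).real (A ∩ B) ≤
      upperProb R A + upperProb R B := by
    intro Q₁ hQ₁ Q₂ hQ₂
    obtain ⟨P₁, hP₁, L₁, hL₁, h₁⟩ := exists_of_mem_posteriorClass h𝓛 hQ₁
    obtain ⟨P₂, hP₂, L₂, hL₂, h₂⟩ := exists_of_mem_posteriorClass h𝓛 hQ₂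
    have hS : MeasurableSet {θ | L₂ θ ≤ L₁ θ} := measurableSet_le (h𝓛 hL₂).1 (h𝓛 hL₁).1
    have hmax : (fun θ => max (L₁ θ) (L₂ θ)) ∈ 𝓛 := by
      convert hpaste L₁ hL₁ L₂ hL₂ _ hS using 1
      ext θ
      by_cases h : θ ∈ {θ | L₂ θ ≤ L₁ θ}
      · rw [Set.piecewise_eq_of_mem _ _ _ h, max_eq_left (show L₂ θ ≤ L₁ θ from h)]
      · rw [Set.piecewise_eq_of_notMem _ _ _ h, max_eq_right (le_of_not_ge (show ¬L₂ θ ≤ L₁ θ from h))]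
    have hmin : (fun θ => min (L₁ θ) (L₂ θ)) ∈ 𝓛 := by
      convert hpaste L₂ hL₂ L₁ hL₁ _ hS using 1
      ext θ
      by_cases h : θ ∈ {θ | L₂ θ ≤ L₁ θ}
      · rw [Set.piecewise_eq_of_mem _ _ _ h, min_eq_right (show L₂ θ ≤ L₁ θ from h)]
      · rw [Set.piecewise_eq_of_notMem _ _ _ h, min_eq_left (le_of_not_ge (show ¬L₂ θ ≤ L₁ θ from h))]
    obtain ⟨M, hUM⟩ := (h𝓛 hmax).2.2
    have hlU : ∀ θ, min (L₁ θ) (L₂ θ) ≤ max (L₁ θ) (L₂ θ) := fun θ => min_le_max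
    have hlM : ∀ θ, min (L₁ θ) (L₂ θ) ≤ M := fun θ => (hlU θ).trans (hUM θ)
    have hmono : Monotone (upperProb 𝒬) := fun _ _ => upperProb_mono
    have hUm := (h𝓛 hmax).1
    have hlm := (h𝓛 hmin).1
    have hc := real_le_div_layerIntegrals h𝓛 hP₁ hL₁ h₁ hmax hmin hUM hlM
      (fun θ => le_max_left _ _) (fun θ => min_le_left _ _) hAB
    have hd := real_le_div_layerIntegrals h𝓛 hP₂ hL₂ h₂ hmax hmin hUM hlM
      (fun θ => le_max_right _ _) (fun θ => min_le_right _ _) hAB'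
    have ha := div_layerIntegrals_le_upperProb hac hne hcl hconc h𝓛 hpaste hmax hmin hUM hlM hA
    have hb := div_layerIntegrals_le_upperProb hac hne hcl hconc h𝓛 hpaste hmax hmin hUM hlM hB
    refine (add_le_add hc hd).trans (le_trans ?_ (add_le_add ha hb))
    have hadd := fun {A B : Set Θ} (hA : MeasurableSet A) (hB : MeasurableSet B) (h : A ⊆ B) =>
      upperLayerIntegral_add_lowerLayerIntegral_mono (M := M) hmono hconc hUm hlm hlU hA hB h
    exact div_add_submodular (integral_nonneg fun s => upperProb_nonneg _)
      (integral_nonneg fun s => sub_nonneg.2 (upperProb_le_one _))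
      (upperLayerIntegral_mono hmono Set.inter_subset_left)
      (upperLayerIntegral_mono hmono Set.inter_subset_right)
      (upperLayerIntegral_mono hmono Set.subset_union_left)
      (upperLayerIntegral_submodular hmono hconc hUm hA hB)
      (lowerLayerIntegral_anti hmono Set.inter_subset_left)
      (lowerLayerIntegral_anti hmono Set.inter_subset_right)
      (lowerLayerIntegral_anti hmono Set.subset_union_left)
      (lowerLayerIntegral_anti hmono Set.subset_union_right)
      (lowerLayerIntegral_supermodular hmono hconc hlm hA hB)
      (hadd hAB' hA Set.inter_subset_left) (hadd hAB' hB Set.inter_subset_right)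
      (hadd hA hAB Set.subset_union_left) (hadd hB hAB Set.subset_union_right)
  have hnn : 0 ≤ upperProb R A + upperProb R B :=
    add_nonneg (upperProb_nonneg A) (upperProb_nonneg B)
  have h1 : ∀ Q₁ ∈ R, (Q₁ : Measure Θ).real (A ∪ B) + upperProb R (A ∩ B) ≤
      upperProb R A + upperProb R B := by
    intro Q₁ hQ₁
    rw [← le_sub_iff_add_le']
    -- The bound must be shown nonnegative, as an empty supremum is 0; the pair `Q₁, Q₁` shows it.
    refine upperProb_le ?_ fun Q₂ hQ₂ => by linarith [key Q₁ hQ₁ Q₂ hQ₂]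
    have := key Q₁ hQ₁ Q₁ hQ₁
    have h0 : 0 ≤ (Q₁ : Measure Θ).real (A ∩ B) := measureReal_nonneg
    linarith
  refine upperProb_le ?_ fun Q₁ hQ₁ => by linarith [h1 Q₁ hQ₁]
  have := upperProb_mono (𝒬 := R) (A := A ∩ B) (B := A) Set.inter_subset_left
  linarith [upperProb_nonneg (𝒬 := R) B]

theorem absolutelyContinuous_of_mem_posteriorClass {C : Set (ProbabilityMeasure Θ)}
    {Q : ProbabilityMeasure Θ} (hQ : Q ∈ posteriorClass μ C 𝓛) : (Q : Measure Θ) ≪ μ := by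
  obtain ⟨_, _, _, _, _, _, _, _, hQ⟩ := hQ
  rw [hQ]
  exact withDensity_absolutelyContinuous _ _

theorem absolutelyContinuous_of_mem_upperCore (h : ∀ P ∈ 𝒬, (P : Measure Θ) ≪ μ)
    {Q : ProbabilityMeasure Θ} (hQ : Q ∈ upperCore (upperProb 𝒬)) : (Q : Measure Θ) ≪ μ := by
  refine Measure.AbsolutelyContinuous.mk fun N hN hμN => ?_
  have h0 : upperProb 𝒬 N ≤ 0 :=
    upperProb_le le_rfl fun P hP => by simp [Measure.real, h P hP hμN]
  exact (measureReal_eq_zero_iff).1 (le_antisymm ((hQ N hN).trans h0) measureReal_nonneg)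

-- The density constraint is imposed at each `θ` separately, so choices on `A` and on `Aᶜ` are
-- independent.
open Classical in
theorem piecewise_mem_likelihoodSet {D : Type*} [MeasurableSpace D]
    {ℒ : Θ → Set (ProbabilityMeasure D)} {dens : Θ → ProbabilityMeasure D → D → ℝ} {y : D} :
    ∀ L ∈ likelihoodSet ℒ dens y, ∀ L' ∈ likelihoodSet ℒ dens y, ∀ A, MeasurableSet A →
      A.piecewise L L' ∈ likelihoodSet ℒ dens y := by
  rintro L ⟨⟨hm, h0, M, hM⟩, hL⟩ L' ⟨⟨hm', h0', M', hM'⟩, hL'⟩ A hA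
  refine ⟨⟨hm.piecewise hA hm', fun θ => ?_, max M M', fun θ => ?_⟩, fun θ => ?_⟩ <;>
    by_cases hθ : θ ∈ A
  · rw [Set.piecewise_eq_of_mem _ _ _ hθ]; exact h0 θ
  · rw [Set.piecewise_eq_of_notMem _ _ _ hθ]; exact h0' θ
  · rw [Set.piecewise_eq_of_mem _ _ _ hθ]; exact (hM θ).trans (le_max_left _ _)
  · rw [Set.piecewise_eq_of_notMem _ _ _ hθ]; exact (hM' θ).trans (le_max_right _ _)
  · rw [Set.piecewise_eq_of_mem _ _ _ hθ]; exact hL θ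
  · rw [Set.piecewise_eq_of_notMem _ _ _ hθ]; exact hL' θ

end Posterior

end

/-! ### Single and iterated updating -/

theorem lemma1 {Θ D : Type*} [MeasurableSpace Θ] [MeasurableSpace D]
    (μ : Measure Θ) [SigmaFinite μ] (ν : Measure D) [SigmaFinite ν]
    (𝒬 : Set (ProbabilityMeasure Θ)) (ℒ : Θ → Set (ProbabilityMeasure D))
    (dens : Θ → ProbabilityMeasure D → D → ℝ)
    -- every prior in the core has a `μ`-density
    (hμ : ∀ P ∈ upperCore (upperProb 𝒬), (P : Measure Θ) ≪ μ)
    -- `dens θ Q` is a `ν`-density of `Q`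
    (hdens : ∀ θ, ∀ Q ∈ upperCore (upperProb (ℒ θ)),
      Measurable (dens θ Q) ∧ (∀ x, 0 ≤ dens θ Q x) ∧
        (Q : Measure D) = ν.withDensity (fun x => ENNReal.ofReal (dens θ Q x)))
    (hQ_ne : (upperCore (upperProb 𝒬)).Nonempty)
    (hQ_cl : WeakStarClosed (upperCore (upperProb 𝒬)))
    (hL_ne : ∀ θ, (upperCore (upperProb (ℒ θ))).Nonempty)
    (hL_cl : ∀ θ, WeakStarClosed (upperCore (upperProb (ℒ θ))))
    (hconc : TwoAlternating (upperProb 𝒬)) :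
    -- preserved concavity
    (∀ y : D, TwoAlternating (upperProb
      (posteriorClass μ (upperCore (upperProb 𝒬)) (likelihoodSet ℒ dens y)))) ∧
    -- iterated updating
    (∀ (y : ℕ → D) (n : ℕ),
      (∀ t < n, (upperCore (upperProb (iteratedPosterior μ 𝒬 ℒ dens y t))).Nonempty ∧
        WeakStarClosed (upperCore (upperProb (iteratedPosterior μ 𝒬 ℒ dens y t)))) →
      TwoAlternating (upperProb (iteratedPosterior μ 𝒬 ℒ dens y n))) := by
  refine ⟨fun y => twoAlternating_upperProb_posteriorClass hμ hQ_ne hQ_cl hconc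
    (fun _ hL => hL.1) piecewise_mem_likelihoodSet, fun y n h => ?_⟩
  -- The induction also carries absolute continuity: posteriors have `μ`-densities, and domination
  -- on `μ`-null sets passes this to the core, which is the next prior set.
  have step : ∀ n, (∀ t < n,
      (upperCore (upperProb (iteratedPosterior μ 𝒬 ℒ dens y t))).Nonempty ∧
        WeakStarClosed (upperCore (upperProb (iteratedPosterior μ 𝒬 ℒ dens y t)))) →
      TwoAlternating (upperProb (iteratedPosterior μ 𝒬 ℒ dens y n)) ∧
        ∀ P ∈ upperCore (upperProb (iteratedPosterior μ 𝒬 ℒ dens y n)), (P : Measure Θ) ≪ μ := by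
    intro n
    induction n with
    | zero => exact fun _ => ⟨hconc, hμ⟩
    | succ n ih =>
      intro h
      obtain ⟨hconc', hac⟩ := ih fun t ht => h t (Nat.lt_succ_of_lt ht)
      obtain ⟨hne, hcl⟩ := h n n.lt_succ_self
      exact ⟨twoAlternating_upperProb_posteriorClass hac hne hcl hconc' (fun _ hL => hL.1)
        piecewise_mem_likelihoodSet, fun P hP => absolutelyContinuous_of_mem_upperCore
          (fun _ hQ => absolutelyContinuous_of_mem_posteriorClass hQ) hP⟩
  exact (step n h).1
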